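/- Call a random matrix $Z\in\mathbb{R}^{N\times(n+m)}$ row-sub-Gaussian with parameter $\sigma>0$ and covariance matrix $\Sigma$ if its rows are independent, identically distributed, zero-mean random vectors $z$ with $\mathbb{E}[zz^T]=\Sigma$ and $\mathbb{E}\,e^{\lambda\langle v,z\rangle}\le e^{\lambda^2\sigma^2/2}$ for all unit vectors $v$ and all $\lambda\in\mathbb{R}$. For $r<n$, $\delta\in(0,1)$ and $K_2\ge K_1>0$, say that $Z$ satisfies weak RIP of order $r$ with constants $\delta,K_1,K_2$ if $$K_1(1-\delta)\|\Delta\|_{\mathrm F}\le \frac{\|Z\Delta\|_{\mathrm F}}{\sqrt N}\le K_2(1+\delta)\|\Delta\|_{\mathrm F}\qquad(\ast)$$ for all $\Delta\in\mathbb{R}^{(n+m)\times n}$ of rank at most $r$, and let $\delta_r(K_1,K_2)$ be the infimum of all $\delta>0$ for which $(\ast)$ holds for all such $\Delta$. Let $\gamma_{\min}(\Sigma)$ and $\gamma_{\max}(\Sigma)$ denote the minimal and maximal singular values of $\Sigma$. Theorem. For any fixed $0<\delta<1$, $\sigma>0$ and $\gamma>0$ there are constants $c,d>0$, depending only on $\delta,\sigma,\gamma$,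 such that the following holds for all integers $m,r,N\ge 0$ and $n>r$. Let $Z\in\mathbb{R}^{N\times(n+m)}$ be row-sub-Gaussian with parameter $\sigma$ and with covariance matrix $\Sigma$ satisfying $\gamma_{\min}(\Sigma)=\gamma$. If $N\ge c(n+m)r$, then with probability at least $1-e^{-dN}$ the matrix $Z$ satisfies weak RIP of order $r$ with constants $\delta$, $K_1=\sqrt{\gamma_{\min}(\Sigma)}$ and $K_2=\sqrt{\gamma_{\max}(\Sigma)}$, and $\delta_r(K_1,K_2)\le\delta$. -/

import Mathlib

open MeasureTheory ProbabilityTheory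
open scoped NNReal

/-- The Frobenius norm `√(trace (Aᵀ A))` of a real matrix. -/
noncomputable def frobNorm {p q : ℕ} (A : Matrix (Fin p) (Fin q) ℝ) : ℝ :=
  √(Matrix.trace (A.transpose * A))

/-- The maximal singular value of a square matrix (singular values are indexed from `0`,
in decreasing order). -/
noncomputable def gammaMax {p : ℕ} (S : Matrix (Fin p) (Fin p) ℝ) : ℝ :=
  (Matrix.toEuclideanLin S).singularValues 0

/-- The minimal singular value of a square matrix of size `p ≥ 1`. -/
noncomputable def gammaMin {p : ℕ} (S : Matrix (Fin p) (Fin p) ℝ) : ℝ :=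
  (Matrix.toEuclideanLin S).singularValues (p - 1)

/-- The two-sided inequality
`K₁ (1 - δ) ‖Δ‖_F ≤ ‖Z Δ‖_F / √N ≤ K₂ (1 + δ) ‖Δ‖_F`
for all `(n + m) × n` matrices `Δ` of rank at most `r`. -/
def WeakRIPBounds {N n m : ℕ} (Z : Matrix (Fin N) (Fin (n + m)) ℝ) (r : ℕ) (δ K₁ K₂ : ℝ) : Prop :=
  ∀ Δ : Matrix (Fin (n + m)) (Fin n) ℝ, Δ.rank ≤ r →
    K₁ * (1 - δ) * frobNorm Δ ≤ frobNorm (Z * Δ) / √(N : ℝ) ∧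
      frobNorm (Z * Δ) / √(N : ℝ) ≤ K₂ * (1 + δ) * frobNorm Δ

/-- `Z` satisfies weak RIP of order `r < n` with constants `δ ∈ (0,1)` and `K₂ ≥ K₁ > 0`. -/
structure WeakRIP {N n m : ℕ} (Z : Matrix (Fin N) (Fin (n + m)) ℝ) (r : ℕ) (δ K₁ K₂ : ℝ) :
    Prop where
  order_lt : r < n
  delta_pos : 0 < δ
  delta_lt_one : δ < 1
  lower_pos : 0 < K₁
  lower_le_upper : K₁ ≤ K₂
  bounds : WeakRIPBounds Z r δ K₁ K₂

/-- The weak-RIP constant `δ_r(K₁, K₂)`: the infimum of the `δ > 0` for which the two-sided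
inequality holds. -/
noncomputable def weakRIPConst {N n m : ℕ} (Z : Matrix (Fin N) (Fin (n + m)) ℝ) (r : ℕ)
    (K₁ K₂ : ℝ) : ℝ :=
  sInf {δ : ℝ | 0 < δ ∧ WeakRIPBounds Z r δ K₁ K₂}

/-- A zero-mean random vector `x` in `ℝᵖ` is sub-Gaussian with parameter `σ` if for every unit
vector `v` and every real `t` the moment `E exp(t ⟨v, x⟩)` is finite and at most
`exp(σ² t² / 2)`. -/
structure IsSubGaussianVector {Ω : Type*} [MeasurableSpace Ω] (P : Measure Ω) {p : ℕ}
    (x : Ω → Fin p → ℝ) (σ : ℝ≥0) : Prop where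
  aemeasurable : AEMeasurable x P
  mean_zero : ∀ a, ∫ ω, x ω a ∂P = 0
  subGaussian : ∀ v : Fin p → ℝ, ∑ a, v a ^ 2 = 1 →
    HasSubgaussianMGF (fun ω => ∑ a, v a * x ω a) (σ ^ 2) P

/-- A random matrix is row-sub-Gaussian with parameter `σ` and covariance matrix `S` if its rows
are independent and identically distributed zero-mean sub-Gaussian vectors with parameter `σ`
and covariance matrix `S`. -/
structure IsRowSubGaussian {Ω : Type*} [MeasurableSpace Ω] (P : Measure Ω) {N p : ℕ}
    (Z : Ω → Matrix (Fin N) (Fin p) ℝ) (σ : ℝ≥0) (S : Matrix (Fin p) (Fin p) ℝ) : Prop where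
  indep : iIndepFun (fun (i : Fin N) (ω : Ω) => Z ω i) P
  identDistrib : ∀ i j : Fin N, IdentDistrib (fun ω => Z ω i) (fun ω => Z ω j) P P
  row_subGaussian : ∀ i : Fin N, IsSubGaussianVector P (fun ω => Z ω i) σ
  covariance_eq : ∀ (i : Fin N) (a b : Fin p),
    covariance (fun ω => Z ω i a) (fun ω => Z ω i b) P = S a b

/-!
For `r = 0` the only admissible `Δ` is `0`. For `r ≥ 1` the assumption gives `N ≥ c (n + m)`, and
this already forces the sample covariance matrix `ZᵀZ / N` to be within `γ δ` of `S` in operator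
norm, up to probability `exp (-d N)`. Since `‖Z Δ‖_F²` is the sum of `‖Z v‖²` over the columns `v`
of `Δ`, and `γ_min ‖v‖² ≤ vᵀ S v ≤ γ_max ‖v‖²`, the two-sided inequality then holds for *all* `Δ`,
whatever their rank (`weakRIPBounds_of_opNorm_le`): the slack `γ δ` is absorbed by
`γ_min (1 - δ) ≥ γ_min (1 - δ)²` and `γ_max (1 + δ) ≤ γ_max (1 + δ)²`.

The operator norm bound (`IsRowSubGaussian.measureReal_lt_opNorm_le`) is a net argument. A maximal
`1/2`-separated subset of the unit sphere of `ℝᵖ` has at most `5 ^ p` points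
(`exists_finset_sphere_net`), and the quadratic form of a symmetric operator on this net controls
its norm up to the factor `32` (`opNorm_le_of_sphere_net`). For one unit vector `v` the deviation
is an average of independent centered squares of sub-Gaussian variables, to which a Bernstein
bound applies (`measureReal_abs_sum_ge_le`). The moment generating function needed there comes
from `E exp (X² / (4 c)) ≤ E exp (g² / 4)` with `g` standard Gaussian (`lintegral_exp_sq_div_le`).
-/

/-! ### Nets on the unit sphere and operator norms -/

section Net

open Metric

variable {E : Type*} [NormedAddCommGroup E]

/-- A maximal `1/2`-separated subset of the unit sphere; its cardinality is bounded by a volume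
comparison. -/
theorem exists_finset_sphere_net [NormedSpace ℝ E] [FiniteDimensional ℝ E] :
    ∃ t : Finset E, t.card ≤ 5 ^ Module.finrank ℝ E ∧ (∀ y ∈ t, ‖y‖ = 1) ∧
      ∀ x : E, ‖x‖ = 1 → ∃ y ∈ t, ‖x - y‖ ≤ 1 / 2 := by
  classical
  have hcard : ∀ s : Finset E, (s : Set E) ⊆ sphere (0 : E) 1 →
      IsSeparated ((1 / 2 : ℝ≥0) : ENNReal) (s : Set E) → s.card ≤ 5 ^ Module.finrank ℝ E := by
    intro s hs hsep
    have hinj : Function.Injective (fun x : E => (2 : ℝ) • x) := smul_right_injective E two_ne_zero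
    -- doubling `s` gives a `1`-separated subset of the ball of radius `2`
    rw [← Finset.card_image_of_injective s hinj]
    refine Besicovitch.card_le_of_separated _ ?_ ?_
    · intro c hc
      obtain ⟨x, hx, rfl⟩ := Finset.mem_image.1 hc
      have : ‖x‖ = 1 := by simpa using hs hx
      simp [norm_smul, this]
    · intro c hc d hd hcd
      obtain ⟨x, hx, rfl⟩ := Finset.mem_image.1 hc
      obtain ⟨y, hy, rfl⟩ := Finset.mem_image.1 hd
      have hxy : x ≠ y := fun h => hcd (by rw [h])
      have h : ((1 / 2 : ℝ≥0) : ENNReal) < edist x y := hsep hx hy hxy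
      rw [edist_nndist, ENNReal.coe_lt_coe, ← NNReal.coe_lt_coe, coe_nndist, dist_eq_norm] at h
      simp only [← smul_sub, norm_smul, Real.norm_ofNat]
      norm_num at h
      linarith
  have hpack : packingNumber (1 / 2) (sphere (0 : E) 1) ≤ (5 ^ Module.finrank ℝ E : ℕ) := by
    refine iSup_le fun C => iSup_le fun hC => iSup_le fun hsep => ?_
    by_contra! hlt
    obtain ⟨D, hDC, hD⟩ := Set.exists_subset_encard_eq (Order.add_one_le_of_lt hlt)
    have hfin : D.Finite := Set.finite_of_encard_eq_coe (k := 5 ^ Module.finrank ℝ E + 1)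
      (by rw [hD]; push_cast; rfl)
    have h := hcard hfin.toFinset (by simpa using hDC.trans hC) (by simpa using hsep.subset hDC)
    rw [hfin.encard_eq_coe_toFinset_card] at hD
    have hD' : hfin.toFinset.card = 5 ^ Module.finrank ℝ E + 1 := by exact_mod_cast hD
    omega
  have htop : packingNumber (1 / 2) (sphere (0 : E) 1) ≠ ⊤ :=
    ne_top_of_le_ne_top (ENat.natCast_ne_top _) hpack
  have henc := encard_maximalSeparatedSet htop
  have hfin : (maximalSeparatedSet (1 / 2) (sphere (0 : E) 1)).Finite :=
    Set.encard_ne_top_iff.1 (henc ▸ htop)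
  refine ⟨hfin.toFinset, ?_, ?_, ?_⟩
  · rw [← henc, hfin.encard_eq_coe_toFinset_card] at hpack
    exact_mod_cast hpack
  · intro y hy
    simpa using maximalSeparatedSet_subset (hfin.mem_toFinset.1 hy)
  · intro x hx
    obtain ⟨y, hy, hxy⟩ := isCover_maximalSeparatedSet htop (x := x) (by simpa using hx)
    refine ⟨y, hfin.mem_toFinset.2 hy, ?_⟩
    have h : edist x y ≤ ((1 / 2 : ℝ≥0) : ENNReal) := hxy
    rw [edist_nndist, ENNReal.coe_le_coe, ← NNReal.coe_le_coe, coe_nndist, dist_eq_norm] at h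
    simpa using h

/-- For a symmetric operator `⟪Tx, x⟫ - ⟪Ty, y⟫ = ⟪T(x - y), x + y⟫`, and `x - y`, `x + y` are
orthogonal with `‖x - y‖ ‖x + y‖ ≤ √15 / 4 < 31 / 32` when `x`, `y` are unit vectors at distance at
most `1 / 2`.  Hence a net of that mesh controls the whole norm. -/
theorem opNorm_le_of_sphere_net [InnerProductSpace ℝ E] {T : E →L[ℝ] E} (hT : T.IsSymmetric)
    {t : Finset E} (ht1 : ∀ y ∈ t, ‖y‖ = 1)
    (ht : ∀ x : E, ‖x‖ = 1 → ∃ y ∈ t, ‖x - y‖ ≤ 1 / 2) {ε : ℝ} (hε : 0 ≤ ε)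
    (h : ∀ y ∈ t, |inner ℝ (T y) y| ≤ ε / 32) : ‖T‖ ≤ ε := by
  have key : ∀ x : E, ‖x‖ = 1 → |inner ℝ (T x) x| ≤ ε / 32 + 31 / 32 * ‖T‖ := by
    intro x hx
    obtain ⟨y, hy, hxy⟩ := ht x hx
    have hy1 := ht1 y hy
    have hsymm : inner ℝ (T x) y = inner ℝ (T y) x := by
      rw [real_inner_comm x (T y)]
      exact hT x y
    have hid : inner ℝ (T x) x - inner ℝ (T y) y = inner ℝ (T (x - y)) (x + y) := by
      rw [map_sub, inner_sub_left, inner_add_right, inner_add_right, hsymm]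
      ring
    have hpar : ‖x + y‖ ^ 2 + ‖x - y‖ ^ 2 = 4 := by
      have := parallelogram_law_with_norm ℝ x y
      rw [hx, hy1] at this
      nlinarith
    have hprod : ‖x - y‖ * ‖x + y‖ ≤ 31 / 32 := by
      refine le_of_sq_le_sq ?_ (by norm_num)
      have h1 : ‖x - y‖ ^ 2 ≤ 1 / 4 := by nlinarith [norm_nonneg (x - y)]
      rw [mul_pow, show ‖x + y‖ ^ 2 = 4 - ‖x - y‖ ^ 2 by linarith]
      nlinarith
    have hb : |inner ℝ (T (x - y)) (x + y)| ≤ ‖T‖ * (31 / 32) :=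
      calc |inner ℝ (T (x - y)) (x + y)| ≤ ‖T (x - y)‖ * ‖x + y‖ := abs_real_inner_le_norm _ _
        _ ≤ ‖T‖ * ‖x - y‖ * ‖x + y‖ := by gcongr; exact T.le_opNorm _
        _ = ‖T‖ * (‖x - y‖ * ‖x + y‖) := by ring
        _ ≤ ‖T‖ * (31 / 32) := by gcongr
    have h1 := abs_add_le (inner ℝ (T y) y) (inner ℝ (T (x - y)) (x + y))
    rw [← hid, add_sub_cancel, hid] at h1
    linarith [h y hy]
  have hle : ‖T‖ ≤ ε / 32 + 31 / 32 * ‖T‖ := by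
    conv_lhs => rw [T.norm_eq_iSup_rayleighQuotient hT]
    refine ciSup_le fun x => ?_
    by_cases hx : x = 0
    · have : 0 ≤ ε / 32 + 31 / 32 * ‖T‖ := by positivity
      simpa [hx] using this
    · have hx' : ‖x‖ ≠ 0 := norm_ne_zero_iff.2 hx
      have := key (‖x‖⁻¹ • x) (by rw [norm_smul, norm_inv, norm_norm, inv_mul_cancel₀ hx'])
      rw [← T.rayleigh_smul x (c := ‖x‖⁻¹) (inv_ne_zero hx')]
      have hn : ‖‖x‖⁻¹ • x‖ = 1 := by rw [norm_smul, norm_inv, norm_norm, inv_mul_cancel₀ hx']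
      simpa [ContinuousLinearMap.rayleighQuotient, ContinuousLinearMap.reApplyInnerSelf_apply, hn]
        using this
  linarith

end Net

/-! ### Quadratic forms and singular values -/

section SingularValues

variable {E : Type*} [NormedAddCommGroup E] [InnerProductSpace ℝ E] [FiniteDimensional ℝ E]

theorem LinearMap.IsSymmetric.inner_apply_self_eq_sum {T : E →ₗ[ℝ] E} (hT : T.IsSymmetric) {p : ℕ}
    (hp : Module.finrank ℝ E = p) (x : E) :
    inner ℝ (T x) x = ∑ i, hT.eigenvalues hp i * inner ℝ (hT.eigenvectorBasis hp i) x ^ 2 := by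
  rw [← (hT.eigenvectorBasis hp).sum_inner_mul_inner]
  refine Finset.sum_congr rfl fun i _ => ?_
  rw [hT, hT.apply_eigenvectorBasis, inner_smul_right, real_inner_comm x]
  simp only [RCLike.ofReal_real_eq_id, id_eq]
  ring

theorem LinearMap.IsSymmetric.mul_sq_le_inner {T : E →ₗ[ℝ] E} (hT : T.IsSymmetric) {p : ℕ}
    (hp : Module.finrank ℝ E = p) {a : ℝ} (ha : ∀ i, a ≤ hT.eigenvalues hp i) (x : E) :
    a * ‖x‖ ^ 2 ≤ inner ℝ (T x) x := by
  rw [hT.inner_apply_self_eq_sum hp, ← (hT.eigenvectorBasis hp).sum_sq_inner_left x,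
    Finset.mul_sum]
  refine Finset.sum_le_sum fun i _ => ?_
  rw [real_inner_comm]
  gcongr
  exact ha i

theorem LinearMap.IsSymmetric.inner_le_mul_sq {T : E →ₗ[ℝ] E} (hT : T.IsSymmetric) {p : ℕ}
    (hp : Module.finrank ℝ E = p) {a : ℝ} (ha : ∀ i, hT.eigenvalues hp i ≤ a) (x : E) :
    inner ℝ (T x) x ≤ a * ‖x‖ ^ 2 := by
  rw [hT.inner_apply_self_eq_sum hp, ← (hT.eigenvectorBasis hp).sum_sq_inner_left x,
    Finset.mul_sum]
  refine Finset.sum_le_sum fun i _ => ?_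
  rw [real_inner_comm]
  gcongr
  exact ha i

theorem inner_adjoint_comp_self (T : E →ₗ[ℝ] E) (x : E) :
    inner ℝ ((LinearMap.adjoint T ∘ₗ T) x) x = ‖T x‖ ^ 2 := by
  rw [LinearMap.comp_apply, LinearMap.adjoint_inner_left, real_inner_self_eq_norm_sq]

theorem singularValues_mul_norm_le (T : E →ₗ[ℝ] E) {p : ℕ} (hp : Module.finrank ℝ E = p) (x : E) :
    T.singularValues (p - 1) * ‖x‖ ≤ ‖T x‖ := by
  refine le_of_sq_le_sq ?_ (norm_nonneg _)
  rw [mul_pow, ← inner_adjoint_comp_self]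
  refine T.isSymmetric_adjoint_comp_self.mul_sq_le_inner hp (fun i => ?_) x
  rw [← T.sq_singularValues_fin]
  exact pow_le_pow_left₀ (T.singularValues_nonneg _)
    (T.singularValues_antitone (by have := i.isLt; omega)) 2

theorem norm_le_singularValues_mul (T : E →ₗ[ℝ] E) (x : E) :
    ‖T x‖ ≤ T.singularValues 0 * ‖x‖ := by
  refine le_of_sq_le_sq ?_ (mul_nonneg (T.singularValues_nonneg _) (norm_nonneg _))
  rw [mul_pow, ← inner_adjoint_comp_self]
  refine T.isSymmetric_adjoint_comp_self.inner_le_mul_sq rfl (fun i => ?_) x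
  rw [← T.sq_singularValues_fin]
  exact pow_le_pow_left₀ (T.singularValues_nonneg _) (T.singularValues_antitone (Nat.zero_le _)) 2

theorem inner_le_singularValues_mul_sq (T : E →ₗ[ℝ] E) (x : E) :
    inner ℝ (T x) x ≤ T.singularValues 0 * ‖x‖ ^ 2 :=
  calc inner ℝ (T x) x ≤ ‖T x‖ * ‖x‖ := real_inner_le_norm _ _
    _ ≤ T.singularValues 0 * ‖x‖ * ‖x‖ := by gcongr; exact norm_le_singularValues_mul T x
    _ = T.singularValues 0 * ‖x‖ ^ 2 := by ring

/-- Positivity matters: for a symmetric `T` the smallest singular value is only the smallest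
`|λ|` over the eigenvalues `λ`. -/
theorem singularValues_mul_sq_le_inner {T : E →ₗ[ℝ] E} (hT : T.IsPositive) {p : ℕ}
    (hp : Module.finrank ℝ E = p) (x : E) :
    T.singularValues (p - 1) * ‖x‖ ^ 2 ≤ inner ℝ (T x) x := by
  refine hT.isSymmetric.mul_sq_le_inner hp (fun i => ?_) x
  have h := singularValues_mul_norm_le T hp (hT.isSymmetric.eigenvectorBasis hp i)
  rw [hT.isSymmetric.apply_eigenvectorBasis, norm_smul, OrthonormalBasis.norm_eq_one, mul_one,
    mul_one] at h
  simpa [abs_of_nonneg (hT.nonneg_eigenvalues hp i)] using h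

end SingularValues

/-! ### Exponential moments of squares of sub-Gaussian variables -/

section ExpSquare

variable {Ω : Type*} [MeasurableSpace Ω] {P : Measure Ω}

theorem integrable_exp_sq_div_four_gaussianReal :
    Integrable (fun g : ℝ => Real.exp (g ^ 2 / 4)) (gaussianReal 0 1) := by
  rw [gaussianReal_of_var_ne_zero _ one_ne_zero,
    integrable_withDensity_iff (measurable_gaussianPDF _ _) (ae_of_all _ fun _ => gaussianPDF_lt_top)]
  have h := (integrable_exp_neg_mul_sq (b := 1 / 4) (by norm_num)).const_mul
    (√(2 * Real.pi * (1 : ℝ≥0)))⁻¹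
  refine h.congr (ae_of_all _ fun g => ?_)
  simp only [toReal_gaussianPDF, gaussianPDFReal]
  rw [mul_left_comm, ← Real.exp_add]
  congr 2
  norm_num
  ring

/-- The constant `E exp(g² / 4)` of a standard Gaussian variable `g`. -/
noncomputable def gaussianExpSq : ℝ := ∫ g, Real.exp (g ^ 2 / 4) ∂gaussianReal 0 1

theorem gaussianExpSq_pos : 0 < gaussianExpSq :=
  integral_exp_pos integrable_exp_sq_div_four_gaussianReal

/-- Gaussian randomization: `exp (X² / (4c))` is the mean of `exp (s g X)` over a standard Gaussian
`g`, with `s² = 1 / (2c)`. Averaging over `X` first, the sub-Gaussian bound leaves the mean of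
`exp (g² / 4)`. Lower integrals are used because the integrability of `exp (X² / (4c))` is part of
the conclusion. -/
theorem lintegral_exp_sq_div_le {X : Ω → ℝ} {c : ℝ≥0} (hc : 0 < c) [IsProbabilityMeasure P]
    (hX : HasSubgaussianMGF X c P) :
    ∫⁻ ω, ENNReal.ofReal (Real.exp (X ω ^ 2 / (4 * c))) ∂P ≤ ENNReal.ofReal gaussianExpSq := by
  have hc' : (0 : ℝ) < c := hc
  set s : ℝ := √(1 / (2 * c)) with hs
  have hs2 : s ^ 2 = 1 / (2 * c) := Real.sq_sqrt (by positivity)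
  have hgauss : ∀ y : ℝ, ENNReal.ofReal (Real.exp (y ^ 2 / (4 * c)))
      = ∫⁻ g, ENNReal.ofReal (Real.exp (s * g * y)) ∂gaussianReal 0 1 := by
    intro y
    have hint : Integrable (fun g : ℝ => Real.exp (s * y * g)) (gaussianReal 0 1) :=
      integrable_exp_mul_gaussianReal _
    have hm : ∫ g, Real.exp (s * y * g) ∂gaussianReal 0 1 = Real.exp (y ^ 2 / (4 * c)) := by
      have := congrFun (mgf_id_gaussianReal (μ := 0) (v := 1)) (s * y)
      simp only [mgf, id] at this
      rw [this]
      congr 1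
      rw [mul_pow, hs2]
      push_cast
      field_simp
      ring
    rw [← hm, ofReal_integral_eq_lintegral_ofReal hint (ae_of_all _ fun _ => (Real.exp_pos _).le)]
    simp only [mul_right_comm]
  simp only [hgauss]
  have hXm := hX.aemeasurable
  rw [lintegral_lintegral_swap]
  · have hle : ∀ g : ℝ, ∫⁻ ω, ENNReal.ofReal (Real.exp (s * g * X ω)) ∂P
        ≤ ENNReal.ofReal (Real.exp (g ^ 2 / 4)) := by
      intro g
      rw [← ofReal_integral_eq_lintegral_ofReal (hX.integrable_exp_mul _)
        (ae_of_all _ fun _ => (Real.exp_pos _).le)]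
      refine ENNReal.ofReal_le_ofReal ((hX.mgf_le (s * g)).trans (Real.exp_le_exp.2 (le_of_eq ?_)))
      rw [mul_pow, hs2]
      field_simp
      ring
    refine (lintegral_mono hle).trans (le_of_eq ?_)
    rw [gaussianExpSq, ofReal_integral_eq_lintegral_ofReal integrable_exp_sq_div_four_gaussianReal
      (ae_of_all _ fun _ => (Real.exp_pos _).le)]
  · have h1 : AEMeasurable (fun q : Ω × ℝ => X q.1) (P.prod (gaussianReal 0 1)) :=
      hXm.comp_quasiMeasurePreserving Measure.quasiMeasurePreserving_fst
    have h2 : AEMeasurable (fun q : Ω × ℝ => q.2) (P.prod (gaussianReal 0 1)) :=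
      measurable_snd.aemeasurable
    exact (((h2.const_mul s).mul h1).exp).ennreal_ofReal

variable [IsProbabilityMeasure P] {X : Ω → ℝ} {c : ℝ≥0}

theorem integrable_exp_sq_div (hc : 0 < c) (hX : HasSubgaussianMGF X c P) :
    Integrable (fun ω => Real.exp (X ω ^ 2 / (4 * c))) P := by
  have hXm := hX.aemeasurable
  refine ⟨AEMeasurable.aestronglyMeasurable (by fun_prop), ?_⟩
  rw [hasFiniteIntegral_iff_ofReal (ae_of_all _ fun _ => (Real.exp_pos _).le)]
  exact (lintegral_exp_sq_div_le hc hX).trans_lt ENNReal.ofReal_lt_top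

theorem integral_exp_sq_div_le (hc : 0 < c) (hX : HasSubgaussianMGF X c P) :
    ∫ ω, Real.exp (X ω ^ 2 / (4 * c)) ∂P ≤ gaussianExpSq := by
  have h := lintegral_exp_sq_div_le hc hX
  rw [← ofReal_integral_eq_lintegral_ofReal (integrable_exp_sq_div hc hX)
    (ae_of_all _ fun _ => (Real.exp_pos _).le)] at h
  exact (ENNReal.ofReal_le_ofReal_iff gaussianExpSq_pos.le).1 h

theorem integral_sq_le (hc : 0 < c) (hX : HasSubgaussianMGF X c P) :
    ∫ ω, X ω ^ 2 ∂P ≤ 4 * c * gaussianExpSq := by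
  have hc' : (0 : ℝ) < c := hc
  have h : ∫ ω, X ω ^ 2 ∂P ≤ ∫ ω, 4 * c * Real.exp (X ω ^ 2 / (4 * c)) ∂P := by
    refine integral_mono (hX.memLp 2).integrable_sq ((integrable_exp_sq_div hc hX).const_mul _)
      fun ω => ?_
    have := Real.add_one_le_exp (X ω ^ 2 / (4 * c))
    calc X ω ^ 2 = 4 * c * (X ω ^ 2 / (4 * c)) := by field_simp
      _ ≤ 4 * c * Real.exp (X ω ^ 2 / (4 * c)) := by gcongr; linarith
  rw [integral_const_mul] at h
  exact h.trans (by gcongr; exact integral_exp_sq_div_le hc hX)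

theorem Real.exp_le_one_add_add_sq_mul_exp_abs (y : ℝ) :
    Real.exp y ≤ 1 + y + y ^ 2 * Real.exp |y| := by
  have h1 : Real.exp y - 1 ≤ y * Real.exp y := by
    have h := Real.add_one_le_exp (-y)
    have hp := Real.exp_pos y
    have hm : Real.exp (-y) * Real.exp y = 1 := by rw [← Real.exp_add]; simp
    nlinarith
  have h2 := Real.add_one_le_exp y
  rcases le_total 0 y with hy | hy
  · rw [abs_of_nonneg hy]
    nlinarith
  · have h3 : 1 ≤ Real.exp |y| := Real.one_le_exp (abs_nonneg y)
    nlinarith [sq_nonneg y]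

/-- The constant `M` such that `E exp (t (X² - E X²)) ≤ exp (M t²)` for `|t| ≤ 1 / (8c)`, where `X`
is sub-Gaussian with variance proxy `c`; it is not optimized. -/
noncomputable def bernsteinConst (c : ℝ) : ℝ :=
  128 * c ^ 2 * (Real.exp gaussianExpSq * gaussianExpSq)

theorem bernsteinConst_pos {c : ℝ} (hc : 0 < c) : 0 < bernsteinConst c := by
  have := gaussianExpSq_pos
  unfold bernsteinConst
  positivity

theorem integrable_exp_mul_centered_sq (hc : 0 < c) (hX : HasSubgaussianMGF X c P) {t : ℝ}
    (ht : |t| ≤ 1 / (8 * c)) (s : ℝ) : Integrable (fun ω => Real.exp (t * (X ω ^ 2 - s))) P := by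
  have hc' : (0 : ℝ) < c := hc
  have hXm := hX.aemeasurable
  refine ((integrable_exp_sq_div hc hX).const_mul (Real.exp (-(t * s)))).mono'
    (AEMeasurable.aestronglyMeasurable (by fun_prop)) (ae_of_all _ fun ω => ?_)
  rw [Real.norm_of_nonneg (Real.exp_pos _).le, ← Real.exp_add]
  refine Real.exp_le_exp.2 ?_
  have : t * X ω ^ 2 ≤ 1 / (8 * c) * X ω ^ 2 := by gcongr; exact (le_abs_self t).trans ht
  have h2 : X ω ^ 2 / (4 * c) = 2 * (1 / (8 * c) * X ω ^ 2) := by field_simp; ring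
  have h3 : 0 ≤ 1 / (8 * c) * X ω ^ 2 := by positivity
  rw [h2]
  linarith

/-- With `Y = X² - E X²`, integrate `exp (tY) ≤ 1 + tY + (tY)² exp |tY|`; the linear term vanishes,
and the last one is at most `128 c² t² exp (|Y| / (4c))`, where `|Y| ≤ X² + 4 c E exp (g² / 4)`. -/
theorem mgf_centered_sq_le (hc : 0 < c) (hX : HasSubgaussianMGF X c P) {t : ℝ}
    (ht : |t| ≤ 1 / (8 * c)) :
    mgf (fun ω => X ω ^ 2 - ∫ ω', X ω' ^ 2 ∂P) P t ≤ Real.exp (bernsteinConst c * t ^ 2) := by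
  have hc' : (0 : ℝ) < c := hc
  have hK := gaussianExpSq_pos
  set s := ∫ ω', X ω' ^ 2 ∂P with hs
  have hs0 : 0 ≤ s := integral_nonneg fun _ => sq_nonneg _
  have hsle : s ≤ 4 * c * gaussianExpSq := integral_sq_le hc hX
  have hX2 : Integrable (fun ω => X ω ^ 2) P := (hX.memLp 2).integrable_sq
  have hpt : ∀ ω, Real.exp (t * (X ω ^ 2 - s)) ≤ 1 + t * (X ω ^ 2 - s)
      + 128 * c ^ 2 * t ^ 2 * Real.exp gaussianExpSq * Real.exp (X ω ^ 2 / (4 * c)) := by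
    intro ω
    set Y := X ω ^ 2 - s with hY
    refine (Real.exp_le_one_add_add_sq_mul_exp_abs (t * Y)).trans ?_
    gcongr 1 + t * Y + ?_
    have habsY : |Y| ≤ X ω ^ 2 + 4 * c * gaussianExpSq := by
      rw [abs_le]
      constructor <;> nlinarith [sq_nonneg (X ω)]
    -- the range `|t| ≤ 1 / (8c)` leaves half of the exponent `|Y| / (4c)` for the factor `Y ^ 2`
    set u := |Y| / (8 * c) with hu
    have hu0 : 0 ≤ u := by positivity
    have h1 : |t * Y| ≤ u := by
      rw [abs_mul, hu, div_eq_mul_one_div, mul_comm |Y|]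
      gcongr
    have h2 : (t * Y) ^ 2 ≤ 128 * c ^ 2 * t ^ 2 * Real.exp u := by
      have h := Real.quadratic_le_exp_of_nonneg hu0
      have hYu : Y ^ 2 = 64 * c ^ 2 * u ^ 2 := by
        rw [hu, div_pow, sq_abs]; field_simp; ring
      rw [mul_pow, hYu]
      have : u ^ 2 / 2 ≤ Real.exp u := by linarith
      calc t ^ 2 * (64 * c ^ 2 * u ^ 2) = 128 * c ^ 2 * t ^ 2 * (u ^ 2 / 2) := by ring
        _ ≤ _ := by gcongr
    calc (t * Y) ^ 2 * Real.exp |t * Y|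
        ≤ 128 * c ^ 2 * t ^ 2 * Real.exp u * Real.exp u := by gcongr
      _ = 128 * c ^ 2 * t ^ 2 * Real.exp (u + u) := by rw [Real.exp_add]; ring
      _ ≤ 128 * c ^ 2 * t ^ 2 * Real.exp (gaussianExpSq + X ω ^ 2 / (4 * c)) := by
          have h3 : u + u = |Y| / (4 * c) := by rw [hu]; field_simp; ring
          have h4 : u + u ≤ gaussianExpSq + X ω ^ 2 / (4 * c) := by
            rw [h3, div_le_iff₀ (by positivity), add_mul, div_mul_cancel₀ _ (by positivity)]
            linarith
          gcongr _ * Real.exp ?_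
      _ = _ := by rw [Real.exp_add]; ring
  have hE := integrable_exp_sq_div hc hX
  have hint0 : Integrable (fun ω => t * (X ω ^ 2 - s)) P :=
    (hX2.sub (integrable_const _)).const_mul _
  have hint1 : Integrable (fun ω => 1 + t * (X ω ^ 2 - s)) P :=
    (integrable_const _).add hint0
  have hcalc : mgf (fun ω => X ω ^ 2 - s) P t ≤ 1 + bernsteinConst c * t ^ 2 := by
    calc mgf (fun ω => X ω ^ 2 - s) P t
        ≤ ∫ ω, (1 + t * (X ω ^ 2 - s)
          + 128 * c ^ 2 * t ^ 2 * Real.exp gaussianExpSq * Real.exp (X ω ^ 2 / (4 * c))) ∂P :=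
          integral_mono (integrable_exp_mul_centered_sq hc hX ht s)
            (hint1.add (hE.const_mul _)) hpt
      _ = 1 + 128 * c ^ 2 * t ^ 2 * Real.exp gaussianExpSq
            * ∫ ω, Real.exp (X ω ^ 2 / (4 * c)) ∂P := by
          rw [integral_add hint1 (hE.const_mul _), integral_const_mul,
            integral_add (integrable_const _) hint0, integral_const_mul,
            integral_sub hX2 (integrable_const _), ← hs]
          simp
      _ ≤ 1 + 128 * c ^ 2 * t ^ 2 * Real.exp gaussianExpSq * gaussianExpSq := by
          gcongr
          exact integral_exp_sq_div_le hc hX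
      _ = 1 + bernsteinConst c * t ^ 2 := by unfold bernsteinConst; ring
  linarith [Real.add_one_le_exp (bernsteinConst c * t ^ 2)]

end ExpSquare

/-! ### A Bernstein inequality -/

section Bernstein

variable {Ω : Type*} [MeasurableSpace Ω] {P : Measure Ω}

/-- Chernoff bound for both tails at `t = ± min t₀ (η / (2M))`, where `t η - M t² ≥ t η / 2`. -/
theorem measureReal_abs_sum_ge_le {N : ℕ} {Y : Fin N → Ω → ℝ}
    (hindep : iIndepFun Y P) (hmeas : ∀ i, AEMeasurable (Y i) P) {M t₀ η : ℝ} (hM : 0 < M)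
    (ht₀ : 0 < t₀) (hη : 0 < η)
    (hint : ∀ i t, |t| ≤ t₀ → Integrable (fun ω => Real.exp (t * Y i ω)) P)
    (hmgf : ∀ i t, |t| ≤ t₀ → mgf (Y i) P t ≤ Real.exp (M * t ^ 2)) :
    P.real {ω | N * η ≤ |∑ i, Y i ω|} ≤
      2 * Real.exp (-(min t₀ (η / (2 * M)) * η / 2 * N)) := by
  have : IsProbabilityMeasure P := hindep.isProbabilityMeasure
  set τ := min t₀ (η / (2 * M)) with hτ
  have hτ0 : 0 < τ := lt_min ht₀ (by positivity)
  have hτ1 : τ ≤ t₀ := min_le_left _ _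
  have hτ2 : M * τ ≤ η / 2 := by
    have : τ ≤ η / (2 * M) := min_le_right _ _
    rw [le_div_iff₀ (by positivity)] at this
    linarith
  have hsum : ∀ t, mgf (∑ i, Y i) P t = ∏ i, mgf (Y i) P t :=
    fun t => hindep.mgf_sum₀ hmeas Finset.univ
  -- the sum has a positive moment generating function, so the integral is not a junk value
  have hsumint : ∀ t, |t| ≤ t₀ → Integrable (fun ω => Real.exp (t * (∑ i, Y i) ω)) P := by
    intro t ht
    by_contra h
    have h0 : mgf (∑ i, Y i) P t = 0 := integral_undef h
    rw [hsum] at h0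
    exact (Finset.prod_pos fun i _ => mgf_pos (hint i t ht)).ne' h0
  have hsumle : ∀ t, |t| ≤ t₀ → mgf (∑ i, Y i) P t ≤ Real.exp (N * (M * t ^ 2)) := by
    intro t ht
    rw [hsum, Real.exp_nat_mul]
    refine (Finset.prod_le_prod (fun i _ => mgf_nonneg) fun i _ => hmgf i t ht).trans (le_of_eq ?_)
    simp
  have hexp : Real.exp (-τ * (N * η)) * Real.exp (N * (M * τ ^ 2))
      ≤ Real.exp (-(τ * η / 2 * N)) := by
    rw [← Real.exp_add]
    refine Real.exp_le_exp.2 ?_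
    have : N * τ * (M * τ) ≤ N * τ * (η / 2) := by gcongr
    nlinarith
  have hup : P.real {ω | N * η ≤ (∑ i, Y i) ω} ≤ Real.exp (-(τ * η / 2 * N)) := by
    have hab : |τ| ≤ t₀ := by rwa [abs_of_pos hτ0]
    refine ((measure_ge_le_exp_mul_mgf _ hτ0.le (hsumint τ hab)).trans ?_).trans hexp
    gcongr
    exact hsumle τ hab
  have hlow : P.real {ω | (∑ i, Y i) ω ≤ -(N * η)} ≤ Real.exp (-(τ * η / 2 * N)) := by
    have hab : |-τ| ≤ t₀ := by rwa [abs_neg, abs_of_pos hτ0]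
    refine ((measure_le_le_exp_mul_mgf _ (neg_nonpos.2 hτ0.le) (hsumint _ hab)).trans ?_).trans hexp
    rw [neg_neg, mul_neg, ← neg_mul]
    gcongr
    simpa using hsumle _ hab
  have hsub : {ω | N * η ≤ |∑ i, Y i ω|} ⊆
      {ω | N * η ≤ (∑ i, Y i) ω} ∪ {ω | (∑ i, Y i) ω ≤ -(N * η)} := by
    intro ω hω
    simp only [Set.mem_union, Set.mem_ofPred_eq, Finset.sum_apply] at hω ⊢
    rcases le_abs.1 hω with h | h
    · exact Or.inl h
    · exact Or.inr (by linarith)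
  calc P.real {ω | N * η ≤ |∑ i, Y i ω|}
      ≤ P.real {ω | N * η ≤ (∑ i, Y i) ω} + P.real {ω | (∑ i, Y i) ω ≤ -(N * η)} :=
        (measureReal_mono hsub).trans (measureReal_union_le _ _)
    _ ≤ _ := by linarith

end Bernstein

/-! ### Deviation of the sample covariance matrix -/

section Covariance

open Matrix

variable {Ω : Type*} [MeasurableSpace Ω] {P : Measure Ω} {N p : ℕ}

theorem IsSubGaussianVector.memLp_apply {x : Ω → Fin p → ℝ} {σ : ℝ≥0}
    (hx : IsSubGaussianVector P x σ) (a : Fin p) : MemLp (fun ω => x ω a) 2 P := by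
  have h := (hx.subGaussian (Pi.single a 1) (by simp [Pi.single_apply])).memLp 2
  simpa [Pi.single_apply] using h

theorem IsSubGaussianVector.integral_sq_eq [IsProbabilityMeasure P] {x : Ω → Fin p → ℝ} {σ : ℝ≥0}
    (hx : IsSubGaussianVector P x σ) {S : Matrix (Fin p) (Fin p) ℝ}
    (hS : ∀ a b, covariance (fun ω => x ω a) (fun ω => x ω b) P = S a b) (v : Fin p → ℝ) :
    ∫ ω, (∑ a, v a * x ω a) ^ 2 ∂P = v ⬝ᵥ S *ᵥ v := by
  have hmem : ∀ a, MemLp (fun ω => v a * x ω a) 2 P := fun a => (hx.memLp_apply a).const_mul _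
  have hmean : ∫ ω, ∑ a, v a * x ω a ∂P = 0 := by
    rw [integral_finsetSum _ fun a _ => (hmem a).integrable one_le_two]
    exact Finset.sum_eq_zero fun a _ => by rw [integral_const_mul, hx.mean_zero, mul_zero]
  have hvar := variance_fun_sum hmem
  rw [variance_of_integral_eq_zero (memLp_finsetSum _ fun a _ => hmem a).aemeasurable hmean]
    at hvar
  rw [hvar]
  simp only [dotProduct, mulVec, Finset.mul_sum, covariance_const_mul_left,
    covariance_const_mul_right, hS]
  refine Finset.sum_congr rfl fun a _ => Finset.sum_congr rfl fun b _ => ?_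
  ring

theorem inner_toEuclideanLin_self (A : Matrix (Fin p) (Fin p) ℝ) (x : EuclideanSpace ℝ (Fin p)) :
    inner ℝ (toEuclideanLin A x) x = x.ofLp ⬝ᵥ A *ᵥ x.ofLp := by
  rw [EuclideanSpace.inner_eq_star_dotProduct]
  simp [toLpLin_apply]

/-- The deviation `ZᵀZ / N - S` of the sample covariance matrix from the covariance matrix. -/
noncomputable def sampleDeviation (Z : Matrix (Fin N) (Fin p) ℝ) (S : Matrix (Fin p) (Fin p) ℝ) :
    Matrix (Fin p) (Fin p) ℝ :=
  (N : ℝ)⁻¹ • (Zᵀ * Z) - S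

theorem dotProduct_sampleDeviation (Z : Matrix (Fin N) (Fin p) ℝ) (S : Matrix (Fin p) (Fin p) ℝ)
    (v : Fin p → ℝ) :
    v ⬝ᵥ sampleDeviation Z S *ᵥ v = (∑ i, (∑ a, v a * Z i a) ^ 2) / N - v ⬝ᵥ S *ᵥ v := by
  have h : v ⬝ᵥ (Zᵀ * Z) *ᵥ v = ∑ i, (∑ a, v a * Z i a) ^ 2 := by
    rw [← mulVec_mulVec, dotProduct_mulVec, vecMul_transpose]
    refine Finset.sum_congr rfl fun i _ => ?_
    simp only [mulVec, dotProduct, mul_comm (Z i _)]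
    ring
  rw [sampleDeviation, sub_mulVec, smul_mulVec, dotProduct_sub, dotProduct_smul, h, smul_eq_mul,
    div_eq_inv_mul]

namespace IsRowSubGaussian

variable [IsProbabilityMeasure P] {Z : Ω → Matrix (Fin N) (Fin p) ℝ} {σ : ℝ≥0}
  {S : Matrix (Fin p) (Fin p) ℝ}

theorem isPositive_covariance (hZ : IsRowSubGaussian P Z σ S) (hN : 0 < N) :
    (toEuclideanLin S).IsPositive := by
  let i : Fin N := ⟨0, hN⟩
  rw [isPositive_toEuclideanLin_iff]
  refine PosSemidef.of_dotProduct_mulVec_nonneg ?_ fun v => ?_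
  · ext a b
    simp only [conjTranspose_apply, star_trivial, ← hZ.covariance_eq i]
    exact covariance_comm _ _
  · rw [star_trivial, ← (hZ.row_subGaussian i).integral_sq_eq (hZ.covariance_eq i)]
    exact integral_nonneg fun _ => sq_nonneg _

theorem measureReal_sampleDeviation_ge_le (hZ : IsRowSubGaussian P Z σ S) (hσ : 0 < σ)
    (hN : 0 < N) {v : Fin p → ℝ} (hv : ∑ a, v a ^ 2 = 1) {η : ℝ} (hη : 0 < η) :
    P.real {ω | η ≤ |v ⬝ᵥ sampleDeviation (Z ω) S *ᵥ v|} ≤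
      2 * Real.exp (-(min (1 / (8 * (σ : ℝ) ^ 2)) (η / (2 * bernsteinConst (σ ^ 2))) * η / 2 * N)) := by
  have hc : 0 < σ ^ 2 := by positivity
  have hc' : (0 : ℝ) < σ ^ 2 := by exact_mod_cast hc
  have hX := fun i => (hZ.row_subGaussian i).subGaussian v hv
  have hE := fun i => (hZ.row_subGaussian i).integral_sq_eq (hZ.covariance_eq i) v
  set s := v ⬝ᵥ S *ᵥ v
  have hindep : iIndepFun (fun (i : Fin N) ω => (∑ a, v a * Z ω i a) ^ 2 - s) P :=
    hZ.indep.comp (fun _ z => (∑ a, v a * z a) ^ 2 - s) fun _ => by fun_prop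
  have h := measureReal_abs_sum_ge_le hindep
    (fun i => ((hX i).aemeasurable.pow_const 2).sub_const s)
    (bernsteinConst_pos hc') (t₀ := 1 / (8 * (σ : ℝ) ^ 2)) (by positivity) hη
    (fun i t ht => by
      simpa using integrable_exp_mul_centered_sq hc (hX i) (t := t) (by simpa using ht) s)
    (fun i t ht => by
      have := mgf_centered_sq_le hc (hX i) (t := t) (by simpa using ht)
      rw [hE i] at this
      simpa using this)
  refine le_trans (measureReal_mono fun ω hω => ?_) h
  have hN' : (0 : ℝ) < N := by exact_mod_cast hN
  simp only [Set.mem_ofPred_eq, dotProduct_sampleDeviation] at hω ⊢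
  rw [Finset.sum_sub_distrib, Finset.sum_const, Finset.card_univ, Fintype.card_fin, nsmul_eq_mul,
    show ∀ y : ℝ, y - N * s = N * (y / N - s) from fun y => by field_simp, abs_mul,
    abs_of_pos hN']
  gcongr

end IsRowSubGaussian

end Covariance

/-! ### From the sample covariance matrix to weak RIP -/

section WeakRIP

open Matrix

variable {N n m p : ℕ}

theorem frobNorm_sq {q : ℕ} (A : Matrix (Fin p) (Fin q) ℝ) :
    frobNorm A ^ 2 = ∑ j, ∑ i, A i j ^ 2 := by
  have h : (Aᵀ * A).trace = ∑ j, ∑ i, A i j ^ 2 := by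
    simp [trace, mul_apply, sq]
  rw [frobNorm, Real.sq_sqrt, h]
  rw [h]
  positivity

theorem frobNorm_nonneg {q : ℕ} (A : Matrix (Fin p) (Fin q) ℝ) : 0 ≤ frobNorm A :=
  Real.sqrt_nonneg _

/-- The bounds for all matrices follow from those for all vectors, applied to the columns. -/
theorem weakRIPBounds_of_forall_vec {Z : Matrix (Fin N) (Fin (n + m)) ℝ} (hN : 0 < N)
    {δ K₁ K₂ : ℝ} (h₂ : 0 ≤ K₂ * (1 + δ))
    (hlow : ∀ v : Fin (n + m) → ℝ,
      (K₁ * (1 - δ)) ^ 2 * ∑ a, v a ^ 2 ≤ (∑ i, (∑ a, v a * Z i a) ^ 2) / N)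
    (hup : ∀ v : Fin (n + m) → ℝ,
      (∑ i, (∑ a, v a * Z i a) ^ 2) / N ≤ (K₂ * (1 + δ)) ^ 2 * ∑ a, v a ^ 2) (r : ℕ) :
    WeakRIPBounds Z r δ K₁ K₂ := by
  intro Δ _
  have hN' : (0 : ℝ) < N := by exact_mod_cast hN
  have hmid : (frobNorm (Z * Δ) / √(N : ℝ)) ^ 2
      = ∑ j, (∑ i, (∑ a, Δ a j * Z i a) ^ 2) / N := by
    rw [div_pow, Real.sq_sqrt hN'.le, frobNorm_sq, Finset.sum_div]
    simp only [mul_apply, mul_comm (Z _ _)]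
  have hnn : 0 ≤ frobNorm (Z * Δ) / √(N : ℝ) := div_nonneg (frobNorm_nonneg _) (Real.sqrt_nonneg _)
  constructor
  · refine le_of_sq_le_sq ?_ hnn
    rw [hmid, mul_pow, frobNorm_sq, Finset.mul_sum]
    exact Finset.sum_le_sum fun j _ => hlow fun a => Δ a j
  · refine le_of_sq_le_sq ?_ (mul_nonneg h₂ (frobNorm_nonneg _))
    rw [hmid, mul_pow, frobNorm_sq, Finset.mul_sum]
    exact Finset.sum_le_sum fun j _ => hup fun a => Δ a j

theorem weakRIPBounds_zero (Z : Matrix (Fin N) (Fin (n + m)) ℝ) (δ K₁ K₂ : ℝ) :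
    WeakRIPBounds Z 0 δ K₁ K₂ := by
  intro Δ hΔ
  have : Δ = 0 := by
    rw [Nat.le_zero, rank, Submodule.finrank_eq_zero, LinearMap.range_eq_bot] at hΔ
    exact toLin'.injective (hΔ.trans (map_zero _).symm)
  subst this
  simp [frobNorm]

theorem weakRIP_and_const_le {Z : Matrix (Fin N) (Fin (n + m)) ℝ} {r : ℕ} (hr : r < n) {δ : ℝ}
    (hδ0 : 0 < δ) (hδ1 : δ < 1) {S : Matrix (Fin (n + m)) (Fin (n + m)) ℝ} (hS : 0 < gammaMin S)
    (h : WeakRIPBounds Z r δ √(gammaMin S) √(gammaMax S)) :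
    WeakRIP Z r δ √(gammaMin S) √(gammaMax S) ∧
      weakRIPConst Z r √(gammaMin S) √(gammaMax S) ≤ δ :=
  ⟨⟨hr, hδ0, hδ1, Real.sqrt_pos.2 hS,
    Real.sqrt_le_sqrt (LinearMap.singularValues_antitone _ (Nat.zero_le _)), h⟩,
    csInf_le ⟨0, fun _ hx => hx.1.le⟩ ⟨hδ0, h⟩⟩

theorem weakRIPBounds_of_opNorm_le {Z : Matrix (Fin N) (Fin (n + m)) ℝ} (hN : 0 < N) {δ : ℝ}
    (hδ0 : 0 < δ) (hδ1 : δ < 1) {S : Matrix (Fin (n + m)) (Fin (n + m)) ℝ}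
    (hS : (toEuclideanLin S).IsPositive)
    (h : ‖(toEuclideanLin (sampleDeviation Z S)).toContinuousLinearMap‖ ≤ gammaMin S * δ) (r : ℕ) :
    WeakRIPBounds Z r δ √(gammaMin S) √(gammaMax S) := by
  have h0 : 0 ≤ gammaMin S := LinearMap.singularValues_nonneg _ _
  have h1 : gammaMin S ≤ gammaMax S := LinearMap.singularValues_antitone _ (Nat.zero_le _)
  have hdev : ∀ v : Fin (n + m) → ℝ, |(∑ i, (∑ a, v a * Z i a) ^ 2) / N - v ⬝ᵥ S *ᵥ v|
      ≤ gammaMin S * δ * ∑ a, v a ^ 2 := by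
    intro v
    set T := (toEuclideanLin (sampleDeviation Z S)).toContinuousLinearMap
    have hb : |inner ℝ (T (WithLp.toLp 2 v)) (WithLp.toLp 2 v)|
        ≤ ‖T‖ * ‖WithLp.toLp 2 v‖ ^ 2 :=
      calc |inner ℝ (T (WithLp.toLp 2 v)) (WithLp.toLp 2 v)|
          ≤ ‖T (WithLp.toLp 2 v)‖ * ‖WithLp.toLp 2 v‖ := abs_real_inner_le_norm _ _
        _ ≤ ‖T‖ * ‖WithLp.toLp 2 v‖ * ‖WithLp.toLp 2 v‖ := by gcongr; exact T.le_opNorm _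
        _ = _ := by ring
    have hin : inner ℝ (T (WithLp.toLp 2 v)) (WithLp.toLp 2 v)
        = v ⬝ᵥ sampleDeviation Z S *ᵥ v := inner_toEuclideanLin_self _ _
    rw [hin, dotProduct_sampleDeviation, EuclideanSpace.real_norm_sq_eq] at hb
    exact hb.trans (by gcongr)
  have hquad : ∀ v : Fin (n + m) → ℝ, gammaMin S * ∑ a, v a ^ 2 ≤ v ⬝ᵥ S *ᵥ v ∧
      v ⬝ᵥ S *ᵥ v ≤ gammaMax S * ∑ a, v a ^ 2 := by
    intro v
    have hl := singularValues_mul_sq_le_inner hS (p := n + m) (by simp) (WithLp.toLp 2 v)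
    have hu := inner_le_singularValues_mul_sq (toEuclideanLin S) (WithLp.toLp 2 v)
    rw [inner_toEuclideanLin_self, EuclideanSpace.real_norm_sq_eq] at hl hu
    exact ⟨hl, hu⟩
  refine weakRIPBounds_of_forall_vec hN (by positivity) (fun v => ?_) (fun v => ?_) r
  all_goals
    have hv : 0 ≤ ∑ a, v a ^ 2 := by positivity
    have hd := abs_le.1 (hdev v)
    obtain ⟨hl, hu⟩ := hquad v
  · rw [mul_pow, Real.sq_sqrt h0]
    have : gammaMin S * (1 - δ) ^ 2 * ∑ a, v a ^ 2
        ≤ gammaMin S * (1 - δ) * ∑ a, v a ^ 2 := by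
      gcongr
      nlinarith
    linarith [hd.1]
  · rw [mul_pow, Real.sq_sqrt (h0.trans h1)]
    have h2 : gammaMin S * δ * ∑ a, v a ^ 2 ≤ gammaMax S * δ * ∑ a, v a ^ 2 := by gcongr
    have : gammaMax S * (1 + δ) * ∑ a, v a ^ 2
        ≤ gammaMax S * (1 + δ) ^ 2 * ∑ a, v a ^ 2 := by
      have := h0.trans h1
      gcongr
      nlinarith
    linarith [hd.2]

end WeakRIP

/-! ### Concentration of the sample covariance matrix and the theorem -/

/-- Union bound over a `1/2`-net of the unit sphere. -/
theorem IsRowSubGaussian.measureReal_lt_opNorm_le {Ω : Type*} [MeasurableSpace Ω] {P : Measure Ω}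
    [IsProbabilityMeasure P] {N p : ℕ} {Z : Ω → Matrix (Fin N) (Fin p) ℝ} {σ : ℝ≥0}
    {S : Matrix (Fin p) (Fin p) ℝ} (hZ : IsRowSubGaussian P Z σ S) (hσ : 0 < σ) (hN : 0 < N)
    {ε : ℝ} (hε : 0 < ε) :
    P.real {ω | ε < ‖(Matrix.toEuclideanLin (sampleDeviation (Z ω) S)).toContinuousLinearMap‖} ≤
      5 ^ p * (2 * Real.exp (-(min (1 / (8 * (σ : ℝ) ^ 2))
        (ε / 32 / (2 * bernsteinConst (σ ^ 2))) * (ε / 32) / 2 * N))) := by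
  obtain ⟨t, htcard, ht1, ht⟩ := exists_finset_sphere_net (E := EuclideanSpace ℝ (Fin p))
  rw [finrank_euclideanSpace_fin] at htcard
  set ρ := 2 * Real.exp (-(min (1 / (8 * (σ : ℝ) ^ 2))
        (ε / 32 / (2 * bernsteinConst (σ ^ 2))) * (ε / 32) / 2 * N)) with hρ
  have hsub : {ω | ε < ‖(Matrix.toEuclideanLin (sampleDeviation (Z ω) S)).toContinuousLinearMap‖}
      ⊆ ⋃ y ∈ t, {ω | ε / 32 ≤ |y.ofLp ⬝ᵥ Matrix.mulVec (sampleDeviation (Z ω) S) y.ofLp|} := by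
    intro ω hω
    by_contra hno
    simp only [Set.mem_iUnion, Set.mem_ofPred_eq, exists_prop, not_exists, not_and, not_le]
      at hno hω
    refine absurd (opNorm_le_of_sphere_net ?_ ht1 ht hε.le fun y hy => ?_) (not_le.2 hω)
    · have hsymm : (Matrix.toEuclideanLin (sampleDeviation (Z ω) S)).IsSymmetric := by
        rw [Matrix.isSymmetric_toEuclideanLin_iff]
        have hS : S.IsHermitian := Matrix.isSymmetric_toEuclideanLin_iff.1
          (hZ.isPositive_covariance hN).isSymmetric
        refine Matrix.IsHermitian.sub ?_ hS
        ext a b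
        simp [Matrix.mul_apply, mul_comm]
      exact hsymm
    · have hin : inner ℝ
          ((Matrix.toEuclideanLin (sampleDeviation (Z ω) S)).toContinuousLinearMap y) y
            = y.ofLp ⬝ᵥ Matrix.mulVec (sampleDeviation (Z ω) S) y.ofLp :=
        inner_toEuclideanLin_self _ _
      rw [hin]
      exact (hno y hy).le
  calc _ ≤ _ := measureReal_mono hsub (measure_ne_top _ _)
    _ ≤ ∑ y ∈ t, P.real {ω | ε / 32 ≤ |y.ofLp ⬝ᵥ Matrix.mulVec (sampleDeviation (Z ω) S) y.ofLp|} :=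
        measureReal_biUnion_finset_le _ _
    _ ≤ ∑ y ∈ t, ρ := by
        refine Finset.sum_le_sum fun y hy => ?_
        refine hZ.measureReal_sampleDeviation_ge_le hσ hN ?_ (by positivity)
        rw [← EuclideanSpace.real_norm_sq_eq, ht1 y hy, one_pow]
    _ = t.card * ρ := by rw [Finset.sum_const, nsmul_eq_mul]
    _ ≤ 5 ^ p * ρ := by
        gcongr
        exact_mod_cast htcard

theorem two_mul_five_pow_le_exp {p : ℕ} (hp : 0 < p) : (5 : ℝ) ^ p * 2 ≤ Real.exp (3 * p) := by
  have he : (2.7 : ℝ) < Real.exp 1 := by linarith [Real.exp_one_gt_d9]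
  have h5 : (5 : ℝ) ≤ Real.exp 2 := by
    rw [show (2 : ℝ) = 1 + 1 by norm_num, Real.exp_add]
    nlinarith
  have h2 : (2 : ℝ) ≤ Real.exp p := by
    have : (1 : ℝ) ≤ p := by exact_mod_cast hp
    linarith [Real.exp_le_exp.2 this]
  calc (5 : ℝ) ^ p * 2 ≤ Real.exp 2 ^ p * Real.exp p := by gcongr
    _ = Real.exp (3 * p) := by rw [← Real.exp_nat_mul, ← Real.exp_add]; congr 1; ring

theorem theorem3 (δ : ℝ) (hδ0 : 0 < δ) (hδ1 : δ < 1) (σ : ℝ≥0) (hσ : 0 < σ)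
    (γ : ℝ) (hγ : 0 < γ) :
    ∃ c d : ℝ, 0 < c ∧ 0 < d ∧
      ∀ (n m r N : ℕ), r < n → c * ((n : ℝ) + (m : ℝ)) * (r : ℝ) ≤ (N : ℝ) →
        ∀ {Ω : Type*} [MeasurableSpace Ω] (P : Measure Ω) [IsProbabilityMeasure P]
          (Z : Ω → Matrix (Fin N) (Fin (n + m)) ℝ) (S : Matrix (Fin (n + m)) (Fin (n + m)) ℝ),
          IsRowSubGaussian P Z σ S → gammaMin S = γ →
            1 - Real.exp (-(d * (N : ℝ))) ≤
              P.real {ω | WeakRIP (Z ω) r δ √(gammaMin S) √(gammaMax S) ∧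
                weakRIPConst (Z ω) r √(gammaMin S) √(gammaMax S) ≤ δ} := by
  have hσ' : (0 : ℝ) < σ := hσ
  have hB : 0 < bernsteinConst (σ ^ 2) := bernsteinConst_pos (by positivity)
  set ε := γ * δ with hε
  have hε0 : 0 < ε := by positivity
  -- `κ` is the Bernstein rate for one vector of the net. The union bound costs the factor
  -- `2 * 5 ^ (n + m) ≤ exp (3 (n + m))`, which `N ≥ (6 / κ) (n + m)` makes at most `exp (κ N / 2)`.
  set κ := min (1 / (8 * (σ : ℝ) ^ 2)) (ε / 32 / (2 * bernsteinConst (σ ^ 2))) * (ε / 32) / 2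
    with hκ
  have hκ0 : 0 < κ := by
    have : 0 < min (1 / (8 * (σ : ℝ) ^ 2)) (ε / 32 / (2 * bernsteinConst (σ ^ 2))) :=
      lt_min (by positivity) (by positivity)
    positivity
  refine ⟨6 / κ, κ / 2, by positivity, by positivity, ?_⟩
  intro n m r N hr hNr Ω _ P _ Z S hZ hS
  have hS0 : 0 < gammaMin S := hS ▸ hγ
  rcases Nat.eq_zero_or_pos r with rfl | hr0
  · have huniv : {ω | WeakRIP (Z ω) 0 δ √(gammaMin S) √(gammaMax S) ∧
        weakRIPConst (Z ω) 0 √(gammaMin S) √(gammaMax S) ≤ δ} = Set.univ :=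
      Set.eq_univ_of_forall fun ω =>
        weakRIP_and_const_le hr hδ0 hδ1 hS0 (weakRIPBounds_zero _ _ _ _)
    rw [huniv, probReal_univ]
    linarith [Real.exp_pos (-(κ / 2 * (N : ℝ)))]
  have hp : 0 < n + m := by omega
  have hp' : (0 : ℝ) < (n + m : ℕ) := by exact_mod_cast hp
  have hr1 : (1 : ℝ) ≤ r := by exact_mod_cast hr0
  have hNp : 6 / κ * (n + m : ℕ) ≤ N := by
    refine le_trans ?_ hNr
    push_cast at hp' ⊢
    exact le_mul_of_one_le_right (by positivity) hr1
  have hN : 0 < N := by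
    have : (0 : ℝ) < N := lt_of_lt_of_le (by positivity) hNp
    exact_mod_cast this
  set good := {ω | WeakRIP (Z ω) r δ √(gammaMin S) √(gammaMax S) ∧
    weakRIPConst (Z ω) r √(gammaMin S) √(gammaMax S) ≤ δ} with hgood
  have hbad : P.real goodᶜ ≤ Real.exp (-(κ / 2 * N)) := by
    have hsub : goodᶜ ⊆ {ω | ε <
        ‖(Matrix.toEuclideanLin (sampleDeviation (Z ω) S)).toContinuousLinearMap‖} := by
      intro ω hω
      by_contra hle
      refine hω (weakRIP_and_const_le hr hδ0 hδ1 hS0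
        (weakRIPBounds_of_opNorm_le hN hδ0 hδ1 (hZ.isPositive_covariance hN) ?_ r))
      rw [hS]
      exact not_lt.1 hle
    refine (measureReal_mono hsub).trans ((hZ.measureReal_lt_opNorm_le hσ hN hε0).trans ?_)
    rw [← hκ, ← mul_assoc]
    calc (5 : ℝ) ^ (n + m) * 2 * Real.exp (-(κ * N))
        ≤ Real.exp (3 * (n + m : ℕ)) * Real.exp (-(κ * N)) := by
          gcongr
          exact two_mul_five_pow_le_exp hp
      _ ≤ Real.exp (-(κ / 2 * N)) := by
          rw [← Real.exp_add]
          refine Real.exp_le_exp.2 ?_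
          rw [div_mul_eq_mul_div, div_le_iff₀ hκ0] at hNp
          linarith
  -- the event need not be measurable, so only subadditivity of the outer measure is used
  have htot : 1 ≤ P.real good + P.real goodᶜ := by
    rw [← probReal_univ (μ := P), ← Set.union_compl_self good]
    exact measureReal_union_le _ _
  linarith
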